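/- Let $\mathcal Z$ be a compact metric space, $\mu$ a Borel probability measure with $\operatorname{supp}\mu=\mathcal Z$, $f:\mathcal Z\times\mathcal Z\to[0,1]$ a continuous, symmetric, positive semi-definite kernel, and $w:\mathcal Z\to(0,\infty)$ continuous with $\int w\,d\mu=1$. Put $\mu_w(dx)=w(x)\,\mu(dx)$. For $\nu\in\{\mu,\mu_w\}$ consider the integral operator $g\mapsto\int f(\cdot,y)g(y)\,\nu(dy)$ on $L_2(\mathcal Z,\nu)$. Let $\lambda_1\ge\lambda_2\ge\dots\ge0$ be its non-zero eigenvalues for $\nu=\mu$, repeated according to multiplicity and padded with zeros if there are only finitely many, and let $u_k$ (for $\lambda_k\neq0$) be corresponding continuous eigenfunctions, orthonormal in $L_2(\mathcal Z,\mu)$ and spanning the eigenspaces of the non-zero eigenvalues. Let $(\tilde\lambda_k,\tilde u_k)$ be such a system for $\nu=\mu_w$; the operator for $\nu=\mu_w$ is denoted $\mathcal A_w$, and $\operatorname{rank}(\mathcal A_w)$ is the number of its non-zero eigenvalues, counted with multiplicity. The Mercer feature maps are $$\phi(x)=(\lambda_k^{1/2}u_k(x))_{k\ge1},\qquad \phi_w(x)=(\tilde\lambda_k^{1/2}\tilde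 u_k(x))_{k\ge1}$$ (an entry with zero eigenvalue is $0$), and $\phi_w^{(r)}(x)\in\mathbb R^r$ consists of the first $r$ entries of $\phi_w(x)$. Let $Z\sim\mu_w$ and $\mathcal K_w=\mathbb E[\phi(Z)\phi(Z)^\top]$, an operator on $\ell_2$. Orthonormal eigenvectors $v_1,\dots,v_r$ of $\mathcal K_w$ with eigenvalues $\kappa_1\ge\dots\ge\kappa_r$ are called top $r$ eigenvectors if every eigenvector of $\mathcal K_w$ orthogonal to all of them has eigenvalue at most $\kappa_r$; write $V_r=[v_1|\cdots|v_r]$. Then $\phi(x),\phi_w(x)\in\ell_2$ for all $x\in\mathcal Z$, $\sum_i\tilde\lambda_i<\infty$, all the expectations and integrals that occur here exist, and for every $r\le\operatorname{rank}(\mathcal A_w)$ the following hold. 1. $$\min_{\Pi_r}\mathbb E\bigl[\|\phi(Z)-\Pi_r\phi(Z)\|^2\bigr]=\sum_{i=r+1}^\infty\tilde\lambda_i,$$ where the minimum is over the orthogonal projections $\Pi_r$ onto $r$-dimensional linear subspaces of $\ell_2$, and is attained. 2. For any top $r$ eigenvectors $v_1,\dots,v_r$ of $\mathcal K_w$, the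 eigenvalue of $v_i$ is $\tilde\lambda_i$ for $i=1,\dots,r$, and $V_rV_r^\top$ is an orthogonal projection onto an $r$-dimensional subspace that attains the minimum in 1. 3. The vectors $v_k=\tilde\lambda_k^{-1/2}\int\tilde u_k(x)\,\phi(x)\,\mu_w(dx)$, $k=1,\dots,r$, are top $r$ eigenvectors of $\mathcal K_w$ with eigenvalues $\tilde\lambda_1,\dots,\tilde\lambda_r$, and with this choice of eigenvectors $V_r^\top\phi(x)=\phi_w^{(r)}(x)$ for all $x\in\mathcal Z$. -/

import Mathlib

open MeasureTheory
open scoped InnerProductSpace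

noncomputable section

/-- The Hilbert space `ℓ₂` of real square-summable sequences (indexed from `0`). -/
abbrev EllTwo : Type := lp (fun _ : ℕ => ℝ) 2

/-- A symmetric positive semi-definite kernel: all its finite quadratic forms are nonnegative. -/
structure IsPosSemidefKernel {Z : Type*} (f : Z → Z → ℝ) : Prop where
  symm : ∀ x y, f x y = f y x
  nonneg : ∀ (n : ℕ) (x : Fin n → Z) (c : Fin n → ℝ),
    0 ≤ ∑ i, ∑ j, c i * c j * f (x i) (x j)

/-- The integral operator `g ↦ ∫ f(·, y) g(y) ν(dy)`. -/
def integralOperator {Z : Type*} [MeasurableSpace Z] (f : Z → Z → ℝ) (ν : Measure Z)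
    (g : Z → ℝ) : Z → ℝ :=
  fun x => ∫ y, f x y * g y ∂ν

/-- `(lam k, u k)` is an ordered system of eigenvalues and eigenfunctions of the integral operator
on `L₂(ν)` with kernel `f`. The sequence `lam` is nonincreasing and lists every nonzero eigenvalue
as often as its multiplicity; it is padded with zeros if there are finitely many. The
eigenfunctions with nonzero eigenvalue are the continuous representatives, are orthonormal in
`L₂(ν)`, and exhaust the eigenspaces: an `L₂(ν)`-eigenfunction with nonzero eigenvalue which is
orthogonal to all of them vanishes. The functions `u k` with `lam k = 0` are irrelevant for the
feature map. -/
structure IsMercerSystem {Z : Type*} [TopologicalSpace Z] [MeasurableSpace Z]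
    (f : Z → Z → ℝ) (ν : Measure Z) (lam : ℕ → ℝ) (u : ℕ → Z → ℝ) : Prop where
  nonneg : ∀ k, 0 ≤ lam k
  antitone : Antitone lam
  continuous : ∀ k, lam k ≠ 0 → Continuous (u k)
  eigen : ∀ k, lam k ≠ 0 → ∀ x, integralOperator f ν (u k) x = lam k * u k x
  orthonormal : ∀ j k, lam j ≠ 0 → lam k ≠ 0 →
    ∫ x, u j x * u k x ∂ν = if j = k then 1 else 0
  complete : ∀ (c : ℝ) (g : Z → ℝ), c ≠ 0 → MemLp g 2 ν →
    integralOperator f ν g =ᵐ[ν] (fun x => c * g x) →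
    (∀ k, lam k ≠ 0 → ∫ x, g x * u k x ∂ν = 0) → g =ᵐ[ν] 0

/-- The number of nonzero eigenvalues, counted with multiplicity. -/
def eigenvalueRank (lam : ℕ → ℝ) : ℕ∞ := {k : ℕ | lam k ≠ 0}.encard

/-- The sequence of coordinates `lam k ^ (1/2) * u k x` of the Mercer feature map at `x`. -/
def mercerCoords {Z : Type*} (lam : ℕ → ℝ) (u : ℕ → Z → ℝ) (x : Z) : ℕ → ℝ :=
  fun k => √(lam k) * u k x

open Classical in
/-- The Mercer feature map with values in `ℓ₂`. (The value `0` is used where the coordinates are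
not square-summable.) -/
def mercerFeatureMap {Z : Type*} (lam : ℕ → ℝ) (u : ℕ → Z → ℝ) (x : Z) : EllTwo :=
  if h : Memℓp (mercerCoords lam u x) 2 then ⟨mercerCoords lam u x, h⟩ else 0

/-- Truncation of a vector in `ℓ₂` to its first `r` entries. -/
def truncate (r : ℕ) (a : EllTwo) : EuclideanSpace ℝ (Fin r) :=
  WithLp.toLp 2 (fun i => a i)

/-- The measure `μ_w(dx) = w(x) μ(dx)`. -/
def weightedMeasure {Z : Type*} [MeasurableSpace Z] (μ : Measure Z) (w : Z → ℝ) : Measure Z :=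
  μ.withDensity (fun x => ENNReal.ofReal (w x))

/-- The uncentred covariance operator `E[φ(Z) φ(Z)ᵀ]` on `ℓ₂`, with `Z ∼ ν`. -/
def covOperator {Z : Type*} [MeasurableSpace Z] (ν : Measure Z) (φ : Z → EllTwo) :
    EllTwo →L[ℝ] EllTwo :=
  ∫ x, InnerProductSpace.rankOne ℝ (φ x) (φ x) ∂ν

/-- `P` is the orthogonal projection of `ℓ₂` onto some `r`-dimensional linear subspace. -/
def IsOrthProjOfRank (r : ℕ) (P : EllTwo →L[ℝ] EllTwo) : Prop :=
  IsStarProjection P ∧ FiniteDimensional ℝ P.range ∧ Module.finrank ℝ P.range = r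

/-- The mean-squared error `E‖φ(Z) - P φ(Z)‖²`, with `Z ∼ ν`. -/
def projError {Z : Type*} [MeasurableSpace Z] (ν : Measure Z) (φ : Z → EllTwo)
    (P : EllTwo →L[ℝ] EllTwo) : ℝ :=
  ∫ x, ‖φ x - P (φ x)‖ ^ 2 ∂ν

/-- `v 0, …, v (r-1)` are orthonormal top `r` eigenvectors of `K`, with the eigenvalues
`κ 0 ≥ ⋯ ≥ κ (r-1)`: no eigenvector orthogonal to them has an eigenvalue that exceeds one of
the `κ i`. -/
structure IsTopEigenvectors {r : ℕ} (K : EllTwo →L[ℝ] EllTwo) (κ : Fin r → ℝ)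
    (v : Fin r → EllTwo) : Prop where
  orthonormal : Orthonormal ℝ v
  antitone : Antitone κ
  eigen : ∀ i, K (v i) = κ i • v i
  top : ∀ (c : ℝ) (y : EllTwo), y ≠ 0 → K y = c • y → (∀ i, ⟪v i, y⟫_ℝ = 0) → ∀ i, c ≤ κ i

/-- The operator `V = [v 0 | ⋯ | v (r-1)]` from `ℝ^r` to `ℓ₂` whose columns are the `v i`. -/
def columns {r : ℕ} (v : Fin r → EllTwo) : EuclideanSpace ℝ (Fin r) →L[ℝ] EllTwo :=
  ∑ i, (EuclideanSpace.proj i : EuclideanSpace ℝ (Fin r) →L[ℝ] ℝ).smulRight (v i)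

/-- The transpose `Vᵀ` of `V = [v 0 | ⋯ | v (r-1)]`. -/
def columnsT {r : ℕ} (v : Fin r → EllTwo) : EllTwo →L[ℝ] EuclideanSpace ℝ (Fin r) :=
  ContinuousLinearMap.adjoint (columns v)

/-- The vector `lam k ^ (-1/2) ∫ u k x φ(x) ν(dx)` of `ℓ₂` which corresponds to the
eigenfunction `u k`. -/
def pairedVector {Z : Type*} [MeasurableSpace Z] (ν : Measure Z) (φ : Z → EllTwo)
    (lam : ℕ → ℝ) (u : ℕ → Z → ℝ) (k : ℕ) : EllTwo :=
  (√(lam k))⁻¹ • ∫ x, u k x • φ x ∂ν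

end

/-! Let T g = ∫ g φ dμ_w, from L₂(μ_w) to ℓ₂. As ⟪φ x, φ y⟫ = f x y, T*T is the integral operator
A_w and TT* is K_w. Hence they share their nonzero eigenvalues, and the T ũ_k / √λ̃_k are
orthonormal eigenvectors of K_w; pairing them with φ x gives √λ̃_k ũ_k(x), which is part 3.

The proof works directly with these vectors, for any continuous feature map Φ of f into a Hilbert
space. The crux is completeness, `inner_eq_zero_of_forall_featureEigenvector`: a vector orthogonal
to all of them is orthogonal to every Φ x. With Parseval this yields Mercer's theorem. It is used
twice: with an abstract Φ, to see that φ is an ℓ₂-valued feature map of f, and then with Φ = φ and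
μ_w, to diagonalise K_w.

The projection with orthonormal basis b has error E‖φ‖² - ∑ ⟪b_j, K_w b_j⟫. Here E‖φ‖² = ∑ λ̃_i
(`hasSum_eigenvalue`), and Ky Fan's inequality `sum_inner_map_le` bounds the subtracted sum. Top
eigenvectors reach the bound because dimension counts force their eigenvalues to be λ̃_i. -/

/-! ### Orthonormal-or-zero families -/

section Bessel

variable {ι H : Type*} [NormedAddCommGroup H] [InnerProductSpace ℝ H] {e : ι → H} {s : Set ι}

/-- Zero vectors add nothing to Bessel's sum. Padding by them lets an eigensystem be indexed by `ℕ`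
even when the rank is finite. -/
theorem sum_inner_sq_le_of_orthonormal_or_zero (he : Orthonormal ℝ (fun i : s => e i))
    (hz : ∀ i ∉ s, e i = 0) (t : Finset ι) (b : H) : ∑ i ∈ t, ⟪e i, b⟫_ℝ ^ 2 ≤ ‖b‖ ^ 2 := by
  classical
  calc ∑ i ∈ t, ⟪e i, b⟫_ℝ ^ 2 = ∑ i ∈ t with i ∈ s, ⟪e i, b⟫_ℝ ^ 2 := by
        rw [Finset.sum_filter]
        refine Finset.sum_congr rfl fun i _ => ?_
        split_ifs with h
        · rfl
        · simp [hz i h]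
    _ = ∑ i ∈ t.subtype (· ∈ s), ⟪e i, b⟫_ℝ ^ 2 :=
        (Finset.sum_subtype_eq_sum_filter (s := t) (p := (· ∈ s))
          (fun i => ⟪e i, b⟫_ℝ ^ 2)).symm
    _ ≤ ‖b‖ ^ 2 := by simpa using he.sum_inner_products_le b (s := t.subtype (· ∈ s))

/-- Parseval's identity for a vector which is orthogonal to everything that is orthogonal to an
orthonormal family. -/
theorem Orthonormal.hasSum_inner_mul_inner_of_orthogonal [CompleteSpace H] {v : ι → H}
    (hv : Orthonormal ℝ v) {x : H} (hx : ∀ y, (∀ i, ⟪v i, y⟫_ℝ = 0) → ⟪x, y⟫_ℝ = 0) (b : H) :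
    HasSum (fun i => ⟪x, v i⟫_ℝ * ⟪v i, b⟫_ℝ) ⟪x, b⟫_ℝ := by
  let E : Submodule ℝ H := (Submodule.span ℝ (Set.range v)).topologicalClosure
  have hE : CompleteSpace E :=
    (Submodule.isClosed_topologicalClosure _).completeSpace_coe
  have hvE : ∀ i, v i ∈ E := fun i =>
    Submodule.le_topologicalClosure _ (Submodule.subset_span ⟨i, rfl⟩)
  have horth : ∀ y ∈ Eᗮ, ∀ i, ⟪v i, y⟫_ℝ = 0 := fun y hy i =>
    (Submodule.mem_orthogonal _ _).1 hy _ (hvE i)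
  have hxE : x ∈ E := by
    rw [← Submodule.orthogonal_orthogonal E]
    refine (Submodule.mem_orthogonal' _ _).2 fun y hy => hx y (horth y hy)
  let w : ι → E := fun i => ⟨v i, hvE i⟩
  have hw : Orthonormal ℝ w := by
    refine ⟨fun i => hv.1 i, fun i j hij => hv.2 hij⟩
  have hwbot : (Submodule.span ℝ (Set.range w))ᗮ = ⊥ := by
    rw [Submodule.eq_bot_iff]
    intro y hy
    have h1 : ∀ i, ⟪v i, (y : H)⟫_ℝ = 0 := fun i =>
      (Submodule.mem_orthogonal _ _).1 hy (w i) (Submodule.subset_span ⟨i, rfl⟩)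
    have h2 : (y : H) ∈ (Submodule.span ℝ (Set.range v))ᗮ := by
      rw [Submodule.mem_orthogonal]
      intro z hz
      induction hz using Submodule.span_induction with
      | mem z hz => obtain ⟨i, rfl⟩ := hz; exact h1 i
      | zero => simp
      | add a b _ _ ha hb => rw [inner_add_left, ha, hb, add_zero]
      | smul c a _ ha => rw [inner_smul_left, ha, mul_zero]
    rw [← Submodule.orthogonal_closure] at h2
    have h3 := (Submodule.mem_orthogonal _ _).1 h2 y y.2
    exact Subtype.ext (inner_self_eq_zero.1 h3)
  have key := (HilbertBasis.mkOfOrthogonalEqBot hw hwbot).hasSum_inner_mul_inner ⟨x, hxE⟩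
    (E.orthogonalProjectionOnto b)
  have hb : ∀ z : E, ⟪z, E.orthogonalProjectionOnto b⟫_ℝ = ⟪(z : H), b⟫_ℝ := fun z => by
    simp
  rw [hb, HilbertBasis.coe_mkOfOrthogonalEqBot] at key
  simp only [hb] at key
  exact key

theorem hasSum_inner_mul_inner_of_orthonormal_or_zero [CompleteSpace H]
    (he : Orthonormal ℝ (fun i : s => e i)) (hz : ∀ i ∉ s, e i = 0) {x : H}
    (hx : ∀ y, (∀ i, ⟪e i, y⟫_ℝ = 0) → ⟪x, y⟫_ℝ = 0) (b : H) :
    HasSum (fun i => ⟪x, e i⟫_ℝ * ⟪e i, b⟫_ℝ) ⟪x, b⟫_ℝ := by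
  have h := he.hasSum_inner_mul_inner_of_orthogonal (x := x) (fun y hy => hx y fun i => by
    by_cases hi : i ∈ s
    · exact hy ⟨i, hi⟩
    · simp [hz i hi]) b
  refine (hasSum_subtype_iff_of_support_subset (s := s)
    (f := fun i => ⟪x, e i⟫_ℝ * ⟪e i, b⟫_ℝ) fun i hi => ?_).1 h
  by_contra hs
  exact hi (by simp [hz i hs])

/-- Fewer than `m + 1` linear conditions have a nontrivial solution in the span of `m + 1`
vectors. -/
theorem exists_ne_zero_inner_sum_eq_zero {m : ℕ} (a : Fin (m + 1) → H) (b : Fin m → H) :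
    ∃ c : Fin (m + 1) → ℝ, c ≠ 0 ∧ ∀ j, ⟪b j, ∑ i, c i • a i⟫_ℝ = 0 := by
  let F : (Fin (m + 1) → ℝ) →ₗ[ℝ] (Fin m → ℝ) :=
    LinearMap.pi fun j => (innerₛₗ ℝ (b j)) ∘ₗ (Fintype.linearCombination ℝ a)
  have hF : LinearMap.ker F ≠ ⊥ := LinearMap.ker_ne_bot_of_finrank_lt (by simp)
  obtain ⟨c, hc, hc0⟩ := (Submodule.ne_bot_iff _).1 hF
  refine ⟨c, hc0, fun j => ?_⟩
  have := congrFun (LinearMap.mem_ker.1 hc) j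
  simpa [F, Fintype.linearCombination_apply] using this

end Bessel

/-! ### Eigensystems of positive operators -/

section Spectral

variable {H : Type*} [NormedAddCommGroup H] [InnerProductSpace ℝ H]

/-- A symmetric operator is diagonalised by an orthonormal sequence of eigenvectors with
nonincreasing positive eigenvalues, padded with zeros, and vanishes on the orthogonal
complement of the sequence. -/
structure IsEigensystem (K : H →L[ℝ] H) (lam : ℕ → ℝ) (e : ℕ → H) : Prop where
  nonneg : ∀ k, 0 ≤ lam k
  antitone : Antitone lam
  symm : ∀ x y, ⟪K x, y⟫_ℝ = ⟪x, K y⟫_ℝ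
  orthonormal : Orthonormal ℝ (fun k : {k | lam k ≠ 0} => e k)
  eq_zero : ∀ k ∉ {k | lam k ≠ 0}, e k = 0
  eigen : ∀ k, K (e k) = lam k • e k
  map_eq_zero : ∀ y, (∀ k, ⟪e k, y⟫_ℝ = 0) → K y = 0

namespace IsEigensystem

variable {K : H →L[ℝ] H} {lam : ℕ → ℝ} {e : ℕ → H}

theorem sum_inner_sq_le (h : IsEigensystem K lam e) (t : Finset ℕ) (b : H) :
    ∑ i ∈ t, ⟪e i, b⟫_ℝ ^ 2 ≤ ‖b‖ ^ 2 :=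
  sum_inner_sq_le_of_orthonormal_or_zero h.orthonormal h.eq_zero t b

theorem norm_le_one (h : IsEigensystem K lam e) (k : ℕ) : ‖e k‖ ≤ 1 := by
  by_cases hk : k ∈ {k | lam k ≠ 0}
  · exact (h.orthonormal.1 ⟨k, hk⟩).le
  · simp [h.eq_zero k hk]

theorem inner_eq_zero (h : IsEigensystem K lam e) {j k : ℕ} (hjk : j ≠ k) : ⟪e j, e k⟫_ℝ = 0 := by
  by_cases hj : j ∈ {k | lam k ≠ 0}
  · by_cases hk : k ∈ {k | lam k ≠ 0}
    · exact h.orthonormal.2 (i := ⟨j, hj⟩) (j := ⟨k, hk⟩) (by simpa using hjk)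
    · simp [h.eq_zero k hk]
  · simp [h.eq_zero j hj]

theorem inner_self (h : IsEigensystem K lam e) {k : ℕ} (hk : lam k ≠ 0) : ⟪e k, e k⟫_ℝ = 1 := by
  rw [real_inner_self_eq_norm_sq, h.orthonormal.1 ⟨k, hk⟩, one_pow]

/-- Eigenvectors with different eigenvalues are orthogonal. -/
theorem inner_eq_zero_of_ne (h : IsEigensystem K lam e) {c d : ℝ} (hcd : c ≠ d) {x y : H}
    (hx : K x = c • x) (hy : K y = d • y) : ⟪x, y⟫_ℝ = 0 := by
  have := h.symm x y
  rw [hx, hy, inner_smul_left, inner_smul_right] at this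
  have h2 : (c - d) * ⟪x, y⟫_ℝ = 0 := by
    rw [sub_mul, sub_eq_zero]; simpa using this
  exact (mul_eq_zero.1 h2).resolve_left (sub_ne_zero.2 hcd)

/-- By symmetry `K b` is orthogonal to the kernel of `K`, so Parseval applies to it; compactness of
`K` is not needed. -/
theorem hasSum_inner_map [CompleteSpace H] (h : IsEigensystem K lam e) (b : H) :
    HasSum (fun k => lam k * ⟪e k, b⟫_ℝ ^ 2) ⟪b, K b⟫_ℝ := by
  have := hasSum_inner_mul_inner_of_orthonormal_or_zero h.orthonormal h.eq_zero (x := K b)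
    (fun y hy => by rw [h.symm, h.map_eq_zero y hy, inner_zero_right]) b
  rw [h.symm] at this
  refine this.congr_fun fun k => ?_
  rw [h.symm, h.eigen, inner_smul_right, real_inner_comm]
  ring

/-- Ky Fan's inequality. -/
theorem sum_inner_map_le [CompleteSpace H] (h : IsEigensystem K lam e) {r : ℕ} {b : Fin r → H}
    (hb : Orthonormal ℝ b) : ∑ j, ⟪b j, K (b j)⟫_ℝ ≤ ∑ k ∈ Finset.range r, lam k := by
  -- The quadratic forms add up to ∑ lam k * p k, with weights in [0, 1] of total at most `r`; such
  -- a sum is largest when the weight sits on the first `r` indices.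
  set p : ℕ → ℝ := fun k => ∑ j, ⟪e k, b j⟫_ℝ ^ 2 with hp
  have hp0 : ∀ k, 0 ≤ p k := fun k => Finset.sum_nonneg fun j _ => sq_nonneg _
  have hp1 : ∀ k, p k ≤ 1 := fun k => by
    calc p k = ∑ j, ‖⟪b j, e k⟫_ℝ‖ ^ 2 := by simp [hp, real_inner_comm]
      _ ≤ ‖e k‖ ^ 2 := hb.sum_inner_products_le _
      _ ≤ 1 := pow_le_one₀ (norm_nonneg _) (h.norm_le_one k)
  have hps : ∀ t : Finset ℕ, ∑ k ∈ t, p k ≤ r := fun t => by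
    rw [hp, Finset.sum_comm]
    calc ∑ j, ∑ k ∈ t, ⟪e k, b j⟫_ℝ ^ 2 ≤ ∑ _j : Fin r, (1 : ℝ) :=
          Finset.sum_le_sum fun j _ => by simpa [hb.1 j] using h.sum_inner_sq_le t (b j)
      _ = r := by simp
  have hsum : HasSum (fun k => lam k * p k) (∑ j, ⟪b j, K (b j)⟫_ℝ) := by
    simp_rw [hp, Finset.mul_sum]
    exact hasSum_sum fun j _ => h.hasSum_inner_map (b j)
  -- Threshold at `lam r`, the first eigenvalue left out: lam k * p k ≤ lam r * p k + (lam k - lam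
  -- r)⁺, and the right-hand sides sum to at most ∑_{k<r} lam k.
  set g : ℕ → ℝ := fun k => if k < r then lam k - lam r else 0 with hg
  have hg0 : ∀ k, 0 ≤ g k := fun k => by
    simp only [hg]
    split_ifs with hk
    · exact sub_nonneg.2 (h.antitone hk.le)
    · exact le_rfl
  have hle : ∀ k, lam k * p k ≤ lam r * p k + g k := fun k => by
    simp only [hg]
    split_ifs with hk
    · nlinarith [h.antitone hk.le, hp1 k]
    · simpa using mul_le_mul_of_nonneg_right (h.antitone (not_lt.1 hk)) (hp0 k)
  refine hasSum_le_of_sum_le hsum fun t => ?_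
  calc ∑ k ∈ t, lam k * p k ≤ ∑ k ∈ t, (lam r * p k + g k) := Finset.sum_le_sum fun k _ => hle k
    _ = lam r * ∑ k ∈ t, p k + ∑ k ∈ t, g k := by rw [Finset.sum_add_distrib, Finset.mul_sum]
    _ ≤ lam r * r + ∑ k ∈ t ∪ Finset.range r, g k := by
        gcongr
        · exact h.nonneg r
        · exact hps t
        · exact fun i _ _ => hg0 i
        · exact Finset.subset_union_left
    _ = lam r * r + ∑ k ∈ Finset.range r, g k := by
        congr 1
        symm
        refine Finset.sum_subset Finset.subset_union_right fun k _ hk => ?_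
        exact if_neg fun h' => hk (Finset.mem_range.2 h')
    _ = ∑ k ∈ Finset.range r, lam k := by
        rw [Finset.sum_congr rfl (g := fun k => lam k - lam r)
          fun k hk => if_pos (Finset.mem_range.1 hk)]
        rw [Finset.sum_sub_distrib]
        simp [mul_comm]

/-- The `k`-th largest eigenvalue bounds the smallest of `k` other eigenvalues. -/
theorem eigenvalue_le [CompleteSpace H] (h : IsEigensystem K lam e) {m : ℕ} {c : ℝ}
    {κ : Fin (m + 1) → ℝ} {v : Fin (m + 1) → H} (hv : Orthonormal ℝ v) (hκ : ∀ i, c ≤ κ i)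
    (heig : ∀ i, K (v i) = κ i • v i) : c ≤ lam m := by
  -- Min-max: some nonzero `y` in the span of `v` is orthogonal to the first `m` vectors `e k`; its
  -- Rayleigh quotient is at least `c` and at most `lam m`.
  obtain ⟨a, ha, hae⟩ := exists_ne_zero_inner_sum_eq_zero v (fun k : Fin m => e k)
  set y := ∑ i, a i • v i with hy
  have hKy : K y = ∑ i, (κ i * a i) • v i := by
    simp only [hy, map_sum, map_smul, heig, smul_smul, mul_comm]
  have h1 : ⟪y, K y⟫_ℝ = ∑ i, a i * (κ i * a i) := by
    rw [hKy, hy, hv.inner_sum]; simp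
  have h2 : ‖y‖ ^ 2 = ∑ i, a i * a i := by
    rw [← real_inner_self_eq_norm_sq, hy, hv.inner_sum]; simp
  have hypos : 0 < ‖y‖ ^ 2 := by
    rw [h2]
    obtain ⟨i, hi⟩ := Function.ne_iff.1 ha
    exact Finset.sum_pos' (fun j _ => mul_self_nonneg _) ⟨i, Finset.mem_univ _, mul_self_pos.2 hi⟩
  have hlow : c * ‖y‖ ^ 2 ≤ ⟪y, K y⟫_ℝ := by
    rw [h1, h2, Finset.mul_sum]
    exact Finset.sum_le_sum fun i _ => by nlinarith [hκ i, mul_self_nonneg (a i)]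
  have hup : ⟪y, K y⟫_ℝ ≤ lam m * ‖y‖ ^ 2 := by
    refine hasSum_le_of_sum_le (h.hasSum_inner_map y) fun t => ?_
    calc ∑ k ∈ t, lam k * ⟪e k, y⟫_ℝ ^ 2 ≤ ∑ k ∈ t, lam m * ⟪e k, y⟫_ℝ ^ 2 := by
          refine Finset.sum_le_sum fun k _ => ?_
          by_cases hk : k < m
          · simp [hae ⟨k, hk⟩]
          · exact mul_le_mul_of_nonneg_right (h.antitone (not_lt.1 hk)) (sq_nonneg _)
      _ = lam m * ∑ k ∈ t, ⟪e k, y⟫_ℝ ^ 2 := by rw [Finset.mul_sum]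
      _ ≤ _ := mul_le_mul_of_nonneg_left (h.sum_inner_sq_le t y) (h.nonneg m)
  exact le_of_mul_le_mul_right (hlow.trans hup) hypos

/-- If `v` consists of `r` orthonormal eigenvectors and some eigenvalue of `v` is exceeded by the
corresponding eigenvalue of the eigensystem, then there is an eigenvector orthogonal to `v` whose
eigenvalue exceeds it, too. -/
theorem exists_eigenvector_of_lt (h : IsEigensystem K lam e) {r : ℕ}
    {κ : Fin r → ℝ} {v : Fin r → H} (hκ : Antitone κ)
    (heig : ∀ i, K (v i) = κ i • v i) (i : Fin r) (hi : lam i ≠ 0) (hlt : κ i < lam i) :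
    ∃ (c : ℝ) (y : H), y ≠ 0 ∧ K y = c • y ∧ (∀ j, ⟪v j, y⟫_ℝ = 0) ∧ κ i < c := by
  classical
  have hpos : 0 < lam i := lt_of_le_of_ne (h.nonneg i) hi.symm
  obtain ⟨a, ha, hav⟩ := exists_ne_zero_inner_sum_eq_zero (fun k : Fin (i + 1) => e k)
    (fun j : Fin i => v ⟨j, j.2.trans i.2⟩)
  obtain ⟨k₀, hk₀⟩ := Function.ne_iff.1 ha
  have hlam : ∀ k : Fin (i + 1), lam i ≤ lam k := fun k => h.antitone (Nat.lt_succ_iff.1 k.2)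
  set c := lam k₀ with hc
  have hκc : κ i < c := hlt.trans_le (hlam k₀)
  -- The combination ∑ a k • e k is orthogonal to `v j` for j < i but need not be an eigenvector.
  -- Its component in the eigenspace of `c` is one, and is nonzero because a k₀ ≠ 0.
  set y := ∑ k ∈ Finset.univ.filter (fun k : Fin (i + 1) => lam k = c), a k • e k with hy
  have hKy : K y = c • y := by
    simp only [hy, map_sum, map_smul, Finset.smul_sum]
    refine Finset.sum_congr rfl fun k hk => ?_
    rw [h.eigen, (Finset.mem_filter.1 hk).2, smul_comm]
  have hyk : ⟪e k₀, y⟫_ℝ = a k₀ := by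
    rw [hy, inner_sum, Finset.sum_eq_single k₀]
    · rw [inner_smul_right, h.inner_self (hpos.trans_le (hlam k₀)).ne', mul_one]
    · intro k _ hk
      rw [inner_smul_right, h.inner_eq_zero (fun h' => hk (Fin.ext h'.symm)), mul_zero]
    · intro hk; simp [hc] at hk
  refine ⟨c, y, ?_, hKy, fun j => ?_, hκc⟩
  · intro h0
    rw [h0, inner_zero_right] at hyk
    exact hk₀ hyk.symm
  · by_cases hj : κ j = c
    -- Here `v j` has eigenvalue `c`, so it is orthogonal to the discarded components, and pairing
    -- it with `y` or with the full combination is the same.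
    · have hji : j < i := lt_of_not_ge fun hij => (hκ hij).not_gt (hj ▸ hκc)
      rw [← hav ⟨j, hji⟩, hy, Finset.sum_filter, inner_sum, inner_sum]
      refine Finset.sum_congr rfl fun k _ => ?_
      split_ifs with hk
      · rfl
      · rw [inner_zero_right, inner_smul_right, h.inner_eq_zero_of_ne (fun h' => hk (h'.symm.trans hj))
          (heig j) (h.eigen k), mul_zero]
    · exact h.inner_eq_zero_of_ne hj (heig j) hKy

/-- A positive eigenvalue with an eigenvector orthogonal to the first `r` vectors of the
eigensystem is one of the remaining eigenvalues. -/
theorem eigenvalue_le_of_orthogonal (h : IsEigensystem K lam e) {r : ℕ} {c : ℝ} {y : H}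
    (hy0 : y ≠ 0) (hy : K y = c • y) (hort : ∀ i < r, ⟪e i, y⟫_ℝ = 0) : c ≤ lam r ∨ c ≤ 0 := by
  by_contra! hc
  refine hy0 ((smul_eq_zero.1 (hy.symm.trans (h.map_eq_zero y fun k => ?_))).resolve_left hc.2.ne')
  by_cases hk : k < r
  · exact hort k hk
  · exact h.inner_eq_zero_of_ne ((h.antitone (not_lt.1 hk)).trans_lt hc.1).ne (h.eigen k) hy

end IsEigensystem

end Spectral

/-! ### Feature maps of a continuous kernel -/

section FeatureMap

/-- The operator `E[Φ(Z) Φ(Z)ᵀ]` with `Z ∼ ν`. -/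
noncomputable def secondMomentOperator {Z H : Type*} [MeasurableSpace Z] [NormedAddCommGroup H]
    [InnerProductSpace ℝ H] (ν : Measure Z) (Φ : Z → H) : H →L[ℝ] H :=
  ∫ x, InnerProductSpace.rankOne ℝ (Φ x) (Φ x) ∂ν

/-- The vector `lam k ^ (-1/2) ∫ u k x Φ(x) ν(dx)`, which corresponds to the eigenfunction `u k` of
the integral operator. -/
noncomputable def featureEigenvector {Z H : Type*} [MeasurableSpace Z] [NormedAddCommGroup H]
    [InnerProductSpace ℝ H] (ν : Measure Z) (Φ : Z → H) (lam : ℕ → ℝ) (u : ℕ → Z → ℝ) (k : ℕ) : H :=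
  (√(lam k))⁻¹ • ∫ x, u k x • Φ x ∂ν

/-- The convention `0⁻¹ = 0` supplies the zero padding, whatever `u k` is. -/
theorem featureEigenvector_eq_zero {Z H : Type*} [MeasurableSpace Z] [NormedAddCommGroup H]
    [InnerProductSpace ℝ H] {ν : Measure Z} {Φ : Z → H} {lam : ℕ → ℝ} {u : ℕ → Z → ℝ} {k : ℕ}
    (hk : lam k = 0) :
    featureEigenvector ν Φ lam u k = 0 := by
  simp [featureEigenvector, hk]

variable {Z : Type*} [MetricSpace Z]
  {H : Type*} [NormedAddCommGroup H] [InnerProductSpace ℝ H] {f : Z → Z → ℝ} {Φ : Z → H}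

/-- ‖Φ y - Φ x‖² = f y y - 2 f y x + f x x, which tends to 0 as y → x. -/
theorem continuous_of_inner_eq_kernel (hf : Continuous (fun p : Z × Z => f p.1 p.2))
    (hΦ : ∀ x y, ⟪Φ x, Φ y⟫_ℝ = f x y) : Continuous Φ := by
  rw [continuous_iff_continuousAt]
  intro x
  rw [ContinuousAt, tendsto_iff_norm_sub_tendsto_zero]
  have h1 : ∀ y, ‖Φ y - Φ x‖ = √(f y y - 2 * f y x + f x x) := fun y => by
    rw [← hΦ, ← hΦ, ← hΦ, real_inner_self_eq_norm_sq, real_inner_self_eq_norm_sq,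
      ← norm_sub_sq_real, Real.sqrt_sq (norm_nonneg _)]
  simp_rw [h1]
  have h2 : Continuous fun y => √(f y y - 2 * f y x + f x x) := by
    have ha : Continuous fun y => f y y := hf.comp (continuous_id.prodMk continuous_id)
    have hb : Continuous fun y => f y x := hf.comp (continuous_id.prodMk continuous_const)
    fun_prop
  have h3 := h2.tendsto x
  have h4 : f x x - 2 * f x x + f x x = 0 := by ring
  rwa [h4, Real.sqrt_zero] at h3

variable [CompactSpace Z] [MeasurableSpace Z] [BorelSpace Z] {ν : Measure Z} [IsProbabilityMeasure ν]

theorem integrable_of_continuous {E : Type*} [NormedAddCommGroup E] {g : Z → E}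
    (hg : Continuous g) : Integrable g ν :=
  hg.integrable_of_hasCompactSupport (HasCompactSupport.of_compactSpace g)

theorem integrable_rankOne (hΦ : Continuous Φ) :
    Integrable (fun x => InnerProductSpace.rankOne ℝ (Φ x) (Φ x)) ν := by
  refine integrable_of_continuous ?_
  have h1 : Continuous fun x => InnerProductSpace.rankOne ℝ (E := H) (F := H) (Φ x) := by fun_prop
  exact h1.clm_apply hΦ

theorem secondMomentOperator_apply (hΦ : Continuous Φ) (y : H) :
    secondMomentOperator ν Φ y = ∫ x, ⟪Φ x, y⟫_ℝ • Φ x ∂ν := by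
  rw [secondMomentOperator, ContinuousLinearMap.integral_apply (integrable_rankOne hΦ)]
  rfl

variable [CompleteSpace H]

theorem inner_secondMomentOperator (hΦ : Continuous Φ) (y z : H) :
    ⟪y, secondMomentOperator ν Φ z⟫_ℝ = ∫ x, ⟪Φ x, y⟫_ℝ * ⟪Φ x, z⟫_ℝ ∂ν := by
  rw [secondMomentOperator_apply hΦ, ← integral_inner]
  · simp_rw [inner_smul_right, real_inner_comm, mul_comm]
  · exact integrable_of_continuous (by fun_prop)

theorem secondMomentOperator_symm (hΦ : Continuous Φ) (y z : H) :
    ⟪secondMomentOperator ν Φ y, z⟫_ℝ = ⟪y, secondMomentOperator ν Φ z⟫_ℝ := by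
  rw [real_inner_comm, inner_secondMomentOperator hΦ, inner_secondMomentOperator hΦ]
  simp_rw [mul_comm]

/-- Compact operators form a closed convex set, and an average of rank-one operators over a
probability measure stays in it. -/
theorem isCompactOperator_secondMomentOperator (hΦ : Continuous Φ) :
    IsCompactOperator (secondMomentOperator ν Φ) := by
  have hconv : Convex ℝ {T : H →L[ℝ] H | IsCompactOperator T} := by
    intro S hS T hT a b _ _ _
    exact (IsCompactOperator.smul hS a).add (IsCompactOperator.smul hT b)
  refine hconv.integral_mem (isClosed_setOfPred_isCompactOperator) (.of_forall fun x => ?_)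
    (integrable_rankOne hΦ)
  exact ((isCompactOperator_of_locallyCompactSpace_dom (innerSL ℝ (Φ x)))).clm_comp
    (ContinuousLinearMap.toSpanSingleton ℝ (Φ x))

/-! ### Mercer systems transported to the feature space -/

section MercerSystem

variable {lam : ℕ → ℝ} {u : ℕ → Z → ℝ}

theorem inner_featureEigenvector (hsys : IsMercerSystem f ν lam u) (hΦc : Continuous Φ) {k : ℕ}
    (hk : lam k ≠ 0) (y : H) :
    ⟪featureEigenvector ν Φ lam u k, y⟫_ℝ = (√(lam k))⁻¹ * ∫ x, u k x * ⟪Φ x, y⟫_ℝ ∂ν := by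
  have hu := hsys.continuous k hk
  rw [featureEigenvector, real_inner_smul_left, real_inner_comm, ← integral_inner]
  · simp_rw [inner_smul_right, real_inner_comm]
  · exact integrable_of_continuous (by fun_prop)

/-- The left side is lam k ^ (-1/2) times the integral operator applied to `u k`, at `x`.
Orthonormality, the eigenvector equation and the Mercer coordinates all follow from this identity.
-/
theorem inner_featureEigenvector_apply (hsys : IsMercerSystem f ν lam u) (hΦc : Continuous Φ)
    (hΦ : ∀ x y, ⟪Φ x, Φ y⟫_ℝ = f x y) (k : ℕ) (x : Z) :
    ⟪featureEigenvector ν Φ lam u k, Φ x⟫_ℝ = √(lam k) * u k x := by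
  by_cases hk : lam k = 0
  · simp [featureEigenvector_eq_zero hk, hk]
  have h1 : ∫ y, u k y * ⟪Φ y, Φ x⟫_ℝ ∂ν = lam k * u k x := by
    rw [← hsys.eigen k hk x, integralOperator]
    simp_rw [← hΦ, real_inner_comm, mul_comm]
  rw [inner_featureEigenvector hsys hΦc hk, h1, ← mul_assoc]
  congr 1
  have h2 := Real.mul_self_sqrt (hsys.nonneg k)
  have h3 : √(lam k) ≠ 0 := (Real.sqrt_ne_zero (hsys.nonneg k)).2 hk
  field_simp
  nlinarith

theorem orthonormal_featureEigenvector (hsys : IsMercerSystem f ν lam u) (hΦc : Continuous Φ)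
    (hΦ : ∀ x y, ⟪Φ x, Φ y⟫_ℝ = f x y) :
    Orthonormal ℝ (fun k : {k | lam k ≠ 0} => featureEigenvector ν Φ lam u k) := by
  classical
  rw [orthonormal_iff_ite]
  rintro ⟨j, hj⟩ ⟨k, hk⟩
  have h1 : ∫ x, u j x * ⟪Φ x, featureEigenvector ν Φ lam u k⟫_ℝ ∂ν
      = √(lam k) * if j = k then 1 else 0 := by
    rw [← hsys.orthonormal j k hj hk, ← integral_const_mul]
    refine integral_congr_ae (.of_forall fun x => ?_)
    simp only
    rw [real_inner_comm, inner_featureEigenvector_apply hsys hΦc hΦ]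
    ring
  simp only [Subtype.mk.injEq]
  rw [inner_featureEigenvector hsys hΦc hj, h1]
  split_ifs with hjk
  · subst hjk
    rw [mul_one, inv_mul_cancel₀ ((Real.sqrt_ne_zero (hsys.nonneg j)).2 hj)]
  · simp

theorem secondMomentOperator_featureEigenvector (hsys : IsMercerSystem f ν lam u)
    (hΦc : Continuous Φ) (hΦ : ∀ x y, ⟪Φ x, Φ y⟫_ℝ = f x y) (k : ℕ) :
    secondMomentOperator ν Φ (featureEigenvector ν Φ lam u k)
      = lam k • featureEigenvector ν Φ lam u k := by
  by_cases hk : lam k = 0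
  · simp [featureEigenvector_eq_zero hk]
  rw [secondMomentOperator_apply hΦc]
  have h1 : ∀ x, ⟪Φ x, featureEigenvector ν Φ lam u k⟫_ℝ • Φ x = √(lam k) • u k x • Φ x := fun x => by
    rw [real_inner_comm, inner_featureEigenvector_apply hsys hΦc hΦ, mul_smul]
  simp_rw [h1]
  rw [integral_smul, featureEigenvector, smul_smul]
  congr 1
  have h2 := Real.mul_self_sqrt (hsys.nonneg k)
  have h3 : √(lam k) ≠ 0 := (Real.sqrt_ne_zero (hsys.nonneg k)).2 hk
  field_simp
  nlinarith

/-- The completeness of a Mercer system in the feature space. -/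
theorem inner_eq_zero_of_forall_featureEigenvector [ν.IsOpenPosMeasure]
    (hsys : IsMercerSystem f ν lam u) (hΦc : Continuous Φ) (hΦ : ∀ x y, ⟪Φ x, Φ y⟫_ℝ = f x y)
    {y : H} (hy : ∀ k, ⟪featureEigenvector ν Φ lam u k, y⟫_ℝ = 0) (x : Z) : ⟪Φ x, y⟫_ℝ = 0 := by
  set C := secondMomentOperator ν Φ with hC
  let M : Submodule ℝ H := (Submodule.span ℝ (Set.range (featureEigenvector ν Φ lam u)))ᗮ
  have hM : ∀ z : H, z ∈ M ↔ ∀ k, ⟪featureEigenvector ν Φ lam u k, z⟫_ℝ = 0 := by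
    intro z
    refine ⟨fun hz k => (Submodule.mem_orthogonal _ _).1 hz _ (Submodule.subset_span ⟨k, rfl⟩),
      fun hz => (Submodule.mem_orthogonal _ _).2 fun w hw => ?_⟩
    induction hw using Submodule.span_induction with
    | mem w hw => obtain ⟨k, rfl⟩ := hw; exact hz k
    | zero => simp
    | add a b _ _ ha hb => rw [inner_add_left, ha, hb, add_zero]
    | smul c a _ ha => rw [inner_smul_left, ha, mul_zero]
  have hinv : ∀ z ∈ M, C z ∈ M := fun z hz => by
    rw [hM] at hz ⊢
    intro k
    rw [hC, ← secondMomentOperator_symm hΦc,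
      secondMomentOperator_featureEigenvector hsys hΦc hΦ, inner_smul_left, hz k, mul_zero]
  have hcomp : CompleteSpace M := by infer_instance
  have hsymm : C.IsSymmetric := fun a b => secondMomentOperator_symm hΦc a b
  let S : M →L[ℝ] M := C.restrict hinv
  have hS_compact : IsCompactOperator S :=
    (isCompactOperator_secondMomentOperator (ν := ν) hΦc).restrict' hinv
  have hS_symm : S.IsSymmetric := hsymm.restrict_invariant hinv
  have hfun : ∀ z : H, Continuous fun x => ⟪Φ x, z⟫_ℝ := fun z => by fun_prop
  -- A compact symmetric operator without nonzero eigenvalues vanishes. An eigenvector `z` in `M`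
  -- with eigenvalue c ≠ 0 would make x ↦ ⟪Φ x, z⟫ an eigenfunction orthogonal to all `u k`, hence
  -- null by `complete`, so that `C z = 0`.
  have hS : S = 0 := by
    refine (ContinuousLinearMap.eq_zero_of_forall_hasEigenvalue_eq_zero hS_compact hS_symm).1 ?_
    intro c hc
    by_contra hc0
    obtain ⟨⟨z, hzM⟩, hz, hz0⟩ := hc.exists_hasEigenvector
    have hCz : C z = c • z := congrArg Subtype.val (Module.End.mem_eigenspace_iff.1 hz)
    have hg : (fun x => ⟪Φ x, z⟫_ℝ) =ᵐ[ν] 0 := by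
      refine hsys.complete c _ hc0 ?_ (.of_forall fun x => ?_) fun k hk => ?_
      · exact (hfun z).memLp_of_hasCompactSupport (HasCompactSupport.of_compactSpace _)
      · have := inner_secondMomentOperator (ν := ν) hΦc (Φ x) z
        rw [← hC, hCz, inner_smul_right] at this
        simp only [integralOperator]
        rw [this]
        simp_rw [← hΦ, real_inner_comm]
      · have := (hM z).1 hzM k
        rw [inner_featureEigenvector hsys hΦc hk] at this
        have h3 : √(lam k) ≠ 0 := (Real.sqrt_ne_zero (hsys.nonneg k)).2 hk
        simpa [h3, mul_comm] using this
    have hCz0 : C z = 0 := by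
      rw [hC, secondMomentOperator_apply hΦc]
      refine integral_eq_zero_of_ae (hg.mono fun x hx => ?_)
      simp only [Pi.zero_apply] at hx ⊢
      rw [hx, zero_smul]
    rw [hCz] at hCz0
    exact hz0 (Subtype.ext ((smul_eq_zero.1 hCz0).resolve_left hc0))
  have hyM : y ∈ M := (hM y).2 hy
  have hCy : C y = 0 := congrArg Subtype.val (DFunLike.congr_fun hS (⟨y, hyM⟩ : M))
  -- Continuity and full support turn this vanishing integral into vanishing at every point.
  have h0 : ∫ x, ⟪Φ x, y⟫_ℝ * ⟪Φ x, y⟫_ℝ ∂ν = 0 := by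
    rw [← inner_secondMomentOperator hΦc, ← hC, hCy, inner_zero_right]
  have h1 := (Continuous.integral_pos_of_hasCompactSupport_nonneg_nonzero
    (μ := ν) (f := fun x => ⟪Φ x, y⟫_ℝ * ⟪Φ x, y⟫_ℝ) (x := x) (by fun_prop)
    (HasCompactSupport.of_compactSpace _) (fun x => mul_self_nonneg _)).mt h0.not_gt
  simpa using h1

theorem isEigensystem_featureEigenvector [ν.IsOpenPosMeasure]
    (hsys : IsMercerSystem f ν lam u) (hΦc : Continuous Φ) (hΦ : ∀ x y, ⟪Φ x, Φ y⟫_ℝ = f x y) :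
    IsEigensystem (secondMomentOperator ν Φ) lam (featureEigenvector ν Φ lam u) where
  nonneg := hsys.nonneg
  antitone := hsys.antitone
  symm := secondMomentOperator_symm hΦc
  orthonormal := orthonormal_featureEigenvector hsys hΦc hΦ
  eq_zero k hk := featureEigenvector_eq_zero (by simpa using hk)
  eigen := secondMomentOperator_featureEigenvector hsys hΦc hΦ
  map_eq_zero y hy := by
    rw [secondMomentOperator_apply hΦc]
    simp [inner_eq_zero_of_forall_featureEigenvector hsys hΦc hΦ hy]

/-- **Mercer's theorem**. -/
theorem hasSum_mercer [ν.IsOpenPosMeasure]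
    (hsys : IsMercerSystem f ν lam u) (hΦc : Continuous Φ) (hΦ : ∀ x y, ⟪Φ x, Φ y⟫_ℝ = f x y)
    (x y : Z) : HasSum (fun k => mercerCoords lam u x k * mercerCoords lam u y k) (f x y) := by
  have h := isEigensystem_featureEigenvector hsys hΦc hΦ
  have := hasSum_inner_mul_inner_of_orthonormal_or_zero h.orthonormal h.eq_zero (x := Φ x)
    (fun z hz => inner_eq_zero_of_forall_featureEigenvector hsys hΦc hΦ hz x) (Φ y)
  rw [hΦ] at this
  refine this.congr_fun fun k => ?_
  rw [real_inner_comm, inner_featureEigenvector_apply hsys hΦc hΦ,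
    inner_featureEigenvector_apply hsys hΦc hΦ]
  rfl

/-- Integrate Parseval's identity for `Φ x` term by term: the `k`-th term integrates to ⟪e k, K (e
k)⟫ = lam k. Bessel's inequality gives the summability that justifies the exchange. -/
theorem hasSum_eigenvalue [ν.IsOpenPosMeasure]
    (hsys : IsMercerSystem f ν lam u) (hΦc : Continuous Φ) (hΦ : ∀ x y, ⟪Φ x, Φ y⟫_ℝ = f x y) :
    HasSum lam (∫ x, ‖Φ x‖ ^ 2 ∂ν) := by
  have h := isEigensystem_featureEigenvector hsys hΦc hΦ
  have hint : ∀ k, Integrable (fun x => ⟪featureEigenvector ν Φ lam u k, Φ x⟫_ℝ ^ 2) ν :=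
    fun k => integrable_of_continuous (by fun_prop)
  have hlam : ∀ k, ∫ x, ⟪featureEigenvector ν Φ lam u k, Φ x⟫_ℝ ^ 2 ∂ν = lam k := fun k => by
    by_cases hk : lam k = 0
    · simp [featureEigenvector_eq_zero hk, hk]
    have := inner_secondMomentOperator (ν := ν) hΦc (featureEigenvector ν Φ lam u k)
      (featureEigenvector ν Φ lam u k)
    rw [h.eigen, inner_smul_right, h.inner_self hk, mul_one] at this
    rw [this]
    simp_rw [real_inner_comm, sq]
  have hsum : Summable lam := by
    refine summable_of_sum_le (c := ∫ x, ‖Φ x‖ ^ 2 ∂ν) hsys.nonneg fun t => ?_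
    simp_rw [← hlam]
    rw [← integral_finsetSum _ fun k _ => hint k]
    exact integral_mono (integrable_finsetSum _ fun k _ => hint k)
      (integrable_of_continuous (by fun_prop)) fun x => h.sum_inner_sq_le t (Φ x)
  have key := hasSum_integral_of_summable_integral_norm hint (by simpa [hlam] using hsum)
  simp_rw [hlam] at key
  have hnorm : ∀ x, ∑' k, ⟪featureEigenvector ν Φ lam u k, Φ x⟫_ℝ ^ 2 = ‖Φ x‖ ^ 2 := fun x => by
    have := hasSum_inner_mul_inner_of_orthonormal_or_zero h.orthonormal h.eq_zero (x := Φ x)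
      (fun z hz => inner_eq_zero_of_forall_featureEigenvector hsys hΦc hΦ hz x) (Φ x)
    rw [real_inner_self_eq_norm_sq] at this
    rw [← this.tsum_eq]
    exact tsum_congr fun k => by rw [real_inner_comm (Φ x), sq]
  simpa only [hnorm] using key

end MercerSystem

end FeatureMap

/-- Every positive semi-definite kernel has a feature map (Moore–Aronszajn). -/
theorem IsPosSemidefKernel.exists_featureMap.{u} {Z : Type u} {f : Z → Z → ℝ}
    (hf : IsPosSemidefKernel f) :
    ∃ (H : Type u) (_ : NormedAddCommGroup H) (_ : InnerProductSpace ℝ H) (_ : CompleteSpace H)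
      (Φ : Z → H), ∀ x y, ⟪Φ x, Φ y⟫_ℝ = f x y := by
  classical
  -- The scalar kernel becomes operator-valued, acting on ℝ by multiplication; the feature vector of
  -- `x` is then the kernel function at `x` applied to 1.
  let K : Matrix Z Z (ℝ →L[ℝ] ℝ) := .of fun x y => f x y • 1
  have hherm : K.IsHermitian := by
    ext x y
    simp [K, Matrix.conjTranspose_apply, hf.symm x y]
  have hK : K.PosSemidef := by
    refine (RKHS.posSemidef_tfae.out 0 2 rfl rfl).2 ⟨hherm, fun c => ?_⟩
    let g := c.support.equivFin.symm
    have hsum : ∀ F : Z → ℝ, ∑ i ∈ c.support, F i = ∑ i, F (g i) := fun F => by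
      rw [← Finset.sum_coe_sort c.support, ← Equiv.sum_comp g]
    have := hf.nonneg c.support.card (fun i => g i) (fun i => c (g i))
    simp only [Finsupp.sum, hsum]
    refine this.trans_eq (Finset.sum_congr rfl fun i _ => Finset.sum_congr rfl fun j _ => ?_)
    simp only [K, Matrix.of_apply, smul_apply]
    simp [hf.symm (g j) (g i)]
    ring
  have : Fact K.PosSemidef := ⟨hK⟩
  refine ⟨RKHS.OfKernel K, inferInstance, inferInstance, inferInstance,
    fun x => RKHS.kerFun (RKHS.OfKernel K) x 1, fun x y => ?_⟩
  rw [← RKHS.kernel_inner, RKHS.OfKernel.kernel_ofKernel]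
  simp [K, hf.symm x y]

/-! ### Orthogonal projections of rank `r` -/

section Projection

variable {r : ℕ}

theorem columns_apply (v : Fin r → EllTwo) (c : EuclideanSpace ℝ (Fin r)) :
    columns v c = ∑ i, c i • v i := by
  simp [columns]

theorem columnsT_apply (v : Fin r → EllTwo) (x : EllTwo) (i : Fin r) :
    columnsT v x i = ⟪v i, x⟫_ℝ := by
  classical
  have h : ⟪EuclideanSpace.single i (1 : ℝ), columnsT v x⟫_ℝ = ⟪v i, x⟫_ℝ := by
    rw [columnsT, ContinuousLinearMap.adjoint_inner_right, columns_apply]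
    congr 1
    rw [Finset.sum_eq_single i (fun j _ hj => by simp [hj]) (by simp)]
    simp
  rw [← h, EuclideanSpace.inner_single_left]
  simp

theorem columns_comp_columnsT_apply (v : Fin r → EllTwo) (x : EllTwo) :
    (columns v ∘L columnsT v) x = ∑ i, ⟪v i, x⟫_ℝ • v i := by
  rw [ContinuousLinearMap.comp_apply, columns_apply]
  simp_rw [columnsT_apply]

theorem Orthonormal.isOrthProjOfRank_columns {v : Fin r → EllTwo} (hv : Orthonormal ℝ v) :
    IsOrthProjOfRank r (columns v ∘L columnsT v) := by
  have hself : ∀ i, (columns v ∘L columnsT v) (v i) = v i := fun i => by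
    rw [columns_comp_columnsT_apply, Finset.sum_eq_single i]
    · rw [real_inner_self_eq_norm_sq, hv.1 i, one_pow, one_smul]
    · intro j _ hj
      rw [hv.2 hj, zero_smul]
    · simp
  have hrange : (columns v ∘L columnsT v).range = Submodule.span ℝ (Set.range v) := by
    apply le_antisymm
    · rintro _ ⟨x, rfl⟩
      change (columns v ∘L columnsT v) x ∈ _
      rw [columns_comp_columnsT_apply]
      exact Submodule.sum_mem _ fun i _ => Submodule.smul_mem _ _ (Submodule.subset_span ⟨i, rfl⟩)
    · rw [Submodule.span_le]
      rintro _ ⟨i, rfl⟩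
      exact ⟨v i, hself i⟩
  refine ⟨⟨?_, ?_⟩, ?_, ?_⟩
  · ext1 x
    change (columns v ∘L columnsT v) ((columns v ∘L columnsT v) x) = (columns v ∘L columnsT v) x
    rw [columns_comp_columnsT_apply v x, map_sum]
    simp_rw [map_smul, hself]
  · rw [ContinuousLinearMap.isSelfAdjoint_iff', ContinuousLinearMap.adjoint_comp, columnsT,
      ContinuousLinearMap.adjoint_adjoint]
  · rw [hrange]
    exact FiniteDimensional.span_of_finite ℝ (Set.finite_range v)
  · rw [hrange, finrank_span_eq_card hv.linearIndependent, Fintype.card_fin]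

/-- Expand `P x` in an orthonormal basis of the range; self-adjointness moves `P` onto the basis
vectors, which it fixes. Minimising over projections thus becomes minimising over orthonormal
families. -/
theorem IsOrthProjOfRank.exists_orthonormal {P : EllTwo →L[ℝ] EllTwo} (hP : IsOrthProjOfRank r P) :
    ∃ b : Fin r → EllTwo, Orthonormal ℝ b ∧ P = columns b ∘L columnsT b := by
  obtain ⟨hproj, hfin, hrank⟩ := hP
  let B := (stdOrthonormalBasis ℝ P.range).reindex (finCongr hrank)
  have hPP : ∀ x, P (P x) = P x := fun x => DFunLike.congr_fun hproj.isIdempotentElem x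
  have hfix : ∀ i, P (B i) = B i := fun i => by
    obtain ⟨x, hx⟩ := (B i).2
    rw [← hx]
    exact hPP x
  refine ⟨fun i => B i, ⟨fun i => B.orthonormal.1 i, fun i j hij => B.orthonormal.2 hij⟩, ?_⟩
  ext1 x
  rw [columns_comp_columnsT_apply]
  have h1 := congrArg Subtype.val (B.sum_repr' ⟨P x, ⟨x, rfl⟩⟩)
  rw [AddSubmonoidClass.coe_finsetSum] at h1
  rw [← show _ = P x from h1]
  refine Finset.sum_congr rfl fun i _ => ?_
  have h2 : ⟪(B i : EllTwo), P x⟫_ℝ = ⟪(B i : EllTwo), x⟫_ℝ := by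
    rw [← ContinuousLinearMap.adjoint_inner_left, hproj.isSelfAdjoint.adjoint_eq, hfix]
  rw [← h2]
  rfl

theorem norm_sub_columns_sq {b : Fin r → EllTwo} (hb : Orthonormal ℝ b) (x : EllTwo) :
    ‖x - (columns b ∘L columnsT b) x‖ ^ 2 = ‖x‖ ^ 2 - ∑ j, ⟪b j, x⟫_ℝ ^ 2 := by
  rw [columns_comp_columnsT_apply, norm_sub_sq_real, inner_sum, ← real_inner_self_eq_norm_sq (∑ i, _),
    hb.inner_sum]
  simp_rw [inner_smul_right, real_inner_comm (b _) x]
  simp only [conj_trivial, ← sq]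
  ring

variable {Z : Type*} [MetricSpace Z] [CompactSpace Z] [MeasurableSpace Z] [BorelSpace Z]
  {ν : Measure Z} [IsProbabilityMeasure ν] {Φ : Z → EllTwo}

/-- Pythagoras, integrated: minimising the error means maximising the trace of the second moment
operator on the subspace. -/
theorem projError_columns (hΦ : Continuous Φ) {b : Fin r → EllTwo} (hb : Orthonormal ℝ b) :
    projError ν Φ (columns b ∘L columnsT b)
      = ∫ x, ‖Φ x‖ ^ 2 ∂ν - ∑ j, ⟪b j, secondMomentOperator ν Φ (b j)⟫_ℝ := by
  have hint : ∀ j, Integrable (fun x => ⟪b j, Φ x⟫_ℝ ^ 2) ν :=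
    fun j => integrable_of_continuous (by fun_prop)
  simp_rw [projError, norm_sub_columns_sq hb]
  rw [integral_sub (integrable_of_continuous (by fun_prop)) (integrable_finsetSum _ fun j _ => hint j),
    integral_finsetSum _ fun j _ => hint j]
  simp_rw [inner_secondMomentOperator hΦ, sq, real_inner_comm (b _)]

end Projection

/-! ### The weighted measure and the Mercer feature map -/

section Weighted

variable {Z : Type*} [MeasurableSpace Z] {μ : Measure Z} {w : Z → ℝ}

theorem isProbabilityMeasure_weightedMeasure (hw : Integrable w μ) (hw0 : ∀ x, 0 < w x)
    (hw1 : ∫ x, w x ∂μ = 1) : IsProbabilityMeasure (weightedMeasure μ w) := by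
  refine ⟨?_⟩
  rw [weightedMeasure, withDensity_apply _ MeasurableSet.univ, setLIntegral_univ,
    ← ofReal_integral_eq_lintegral_ofReal hw (.of_forall fun x => (hw0 x).le), hw1,
    ENNReal.ofReal_one]

theorem isOpenPosMeasure_weightedMeasure [TopologicalSpace Z] [μ.IsOpenPosMeasure]
    (hw : Measurable w) (hw0 : ∀ x, 0 < w x) : (weightedMeasure μ w).IsOpenPosMeasure :=
  (withDensity_absolutelyContinuous' hw.ennreal_ofReal.aemeasurable
    (.of_forall fun x => (ENNReal.ofReal_pos.2 (hw0 x)).ne')).isOpenPosMeasure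

end Weighted

section MercerFeatureMap

theorem mercerFeatureMap_coe {Z : Type*} {lam : ℕ → ℝ} {u : ℕ → Z → ℝ} {x : Z}
    (h : Memℓp (mercerCoords lam u x) 2) (k : ℕ) :
    mercerFeatureMap lam u x k = √(lam k) * u k x := by
  rw [mercerFeatureMap, dif_pos h]
  rfl

variable {Z : Type*} [MetricSpace Z] [CompactSpace Z] [MeasurableSpace Z] [BorelSpace Z]
  {ν : Measure Z} [IsProbabilityMeasure ν] [ν.IsOpenPosMeasure] {f : Z → Z → ℝ}
  {lam : ℕ → ℝ} {u : ℕ → Z → ℝ}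

/-- The abstract feature map is only auxiliary: the conclusion does not mention it, and
square-summability of the Mercer coordinates is deduced from the case x = y. -/
theorem IsMercerSystem.hasSum_mul (hsys : IsMercerSystem f ν lam u)
    (hf : Continuous (fun p : Z × Z => f p.1 p.2)) (hpsd : IsPosSemidefKernel f) (x y : Z) :
    HasSum (fun k => mercerCoords lam u x k * mercerCoords lam u y k) (f x y) := by
  obtain ⟨H, _, _, _, Φ, hΦ⟩ := hpsd.exists_featureMap
  exact hasSum_mercer hsys (continuous_of_inner_eq_kernel hf hΦ) hΦ x y

theorem IsMercerSystem.memℓp (hsys : IsMercerSystem f ν lam u)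
    (hf : Continuous (fun p : Z × Z => f p.1 p.2)) (hpsd : IsPosSemidefKernel f) (x : Z) :
    Memℓp (mercerCoords lam u x) 2 := by
  refine memℓp_gen ?_
  simpa [← sq] using (hsys.hasSum_mul hf hpsd x x).summable

theorem IsMercerSystem.inner_mercerFeatureMap (hsys : IsMercerSystem f ν lam u)
    (hf : Continuous (fun p : Z × Z => f p.1 p.2)) (hpsd : IsPosSemidefKernel f) (x y : Z) :
    ⟪mercerFeatureMap lam u x, mercerFeatureMap lam u y⟫_ℝ = f x y := by
  refine (lp.hasSum_inner _ _).unique ((hsys.hasSum_mul hf hpsd x y).congr_fun fun k => ?_)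
  rw [mercerFeatureMap_coe (hsys.memℓp hf hpsd x), mercerFeatureMap_coe (hsys.memℓp hf hpsd y)]
  exact mul_comm _ _

end MercerFeatureMap

/-! ### The top eigenvectors -/

section Top

variable {K : EllTwo →L[ℝ] EllTwo} {lam : ℕ → ℝ} {e : ℕ → EllTwo} {r : ℕ}

/-- A zero at index `i` forces zeros from there on, leaving at most `i` nonzero eigenvalues. -/
theorem ne_zero_of_lt_eigenvalueRank (hanti : Antitone lam) (hnonneg : ∀ k, 0 ≤ lam k)
    (hr : (r : ℕ∞) ≤ eigenvalueRank lam) {i : ℕ} (hi : i < r) : lam i ≠ 0 := by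
  intro h0
  have hsub : {k | lam k ≠ 0} ⊆ (Finset.range i : Set ℕ) := fun k hk => by
    rw [Finset.coe_range, Set.mem_Iio]
    by_contra! hik
    exact hk (le_antisymm (h0 ▸ hanti hik) (hnonneg k))
  have h1 := hr.trans (Set.encard_le_encard hsub)
  rw [Set.encard_coe_eq_coe_finsetCard, Finset.card_range] at h1
  exact absurd (Nat.cast_le.1 h1) (not_le.2 hi)

theorem IsEigensystem.isTopEigenvectors (h : IsEigensystem K lam e)
    (hr : ∀ i < r, lam i ≠ 0) :
    IsTopEigenvectors K (fun i : Fin r => lam i) (fun i : Fin r => e i) where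
  orthonormal := ⟨fun i => h.orthonormal.1 ⟨i, hr i i.2⟩,
    fun _ _ hij => h.inner_eq_zero fun h' => hij (Fin.ext h')⟩
  antitone _ _ hij := h.antitone hij
  eigen i := h.eigen i
  top _ _ hy0 hy hort i :=
    (h.eigenvalue_le_of_orthogonal hy0 hy fun j hj => hort ⟨j, hj⟩).elim
      (fun hc => hc.trans (h.antitone i.2.le)) fun hc => hc.trans (h.nonneg i)

/-- Min-max on the first i + 1 vectors gives ≤. If the inequality were strict, some eigenvector
orthogonal to `v` would violate `top`. -/
theorem IsTopEigenvectors.eigenvalue_eq {κ : Fin r → ℝ} {v : Fin r → EllTwo}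
    (hv : IsTopEigenvectors K κ v) (h : IsEigensystem K lam e) (hr : ∀ i < r, lam i ≠ 0)
    (i : Fin r) : κ i = lam i := by
  apply le_antisymm
  · exact h.eigenvalue_le (κ := fun j => κ (Fin.castLE i.2 j)) (v := fun j => v (Fin.castLE i.2 j))
      (hv.orthonormal.comp _ (Fin.castLE_injective _))
      (fun j => hv.antitone (Fin.le_def.2 (Nat.lt_succ_iff.1 j.2))) fun j => hv.eigen _
  · by_contra! hlt
    obtain ⟨c, y, hy0, hy, hort, hc⟩ :=
      h.exists_eigenvector_of_lt hv.antitone hv.eigen i (hr i i.2) hlt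
    exact absurd (hv.top _ _ hy0 hy hort i) (not_le.2 hc)

theorem IsTopEigenvectors.sum_inner {κ : Fin r → ℝ} {v : Fin r → EllTwo}
    (hv : IsTopEigenvectors K κ v) : ∑ j, ⟪v j, K (v j)⟫_ℝ = ∑ j, κ j := by
  simp [hv.eigen, inner_smul_right, hv.orthonormal.1]

end Top

/-! ### The theorem -/

theorem mainTheorem1 {Z : Type*} [MetricSpace Z] [CompactSpace Z] [MeasurableSpace Z]
    [BorelSpace Z] (μ : Measure Z) [IsProbabilityMeasure μ] [μ.IsOpenPosMeasure]
    (f : Z → Z → ℝ) (hf_cont : Continuous (fun p : Z × Z => f p.1 p.2))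
    (hf_mem : ∀ x y, f x y ∈ Set.Icc (0 : ℝ) 1) (hf_psd : IsPosSemidefKernel f)
    (w : Z → ℝ) (hw_cont : Continuous w) (hw_pos : ∀ x, 0 < w x) (hw_int : ∫ x, w x ∂μ = 1)
    (lam : ℕ → ℝ) (u : ℕ → Z → ℝ) (hsys : IsMercerSystem f μ lam u)
    (lamw : ℕ → ℝ) (uw : ℕ → Z → ℝ)
    (hsysw : IsMercerSystem f (weightedMeasure μ w) lamw uw)
    (φ : Z → EllTwo) (hφ : φ = mercerFeatureMap lam u)
    (φw : Z → EllTwo) (hφw : φw = mercerFeatureMap lamw uw)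
    (K : EllTwo →L[ℝ] EllTwo) (hK : K = covOperator (weightedMeasure μ w) φ)
    (r : ℕ) (hr : (r : ℕ∞) ≤ eigenvalueRank lamw) :
    -- all objects are well defined
    ((∀ x, Memℓp (mercerCoords lam u x) 2) ∧
      (∀ x, Memℓp (mercerCoords lamw uw x) 2) ∧
      Integrable (fun x => InnerProductSpace.rankOne ℝ (φ x) (φ x)) (weightedMeasure μ w) ∧
      (∀ P, IsOrthProjOfRank r P →
        Integrable (fun x => ‖φ x - P (φ x)‖ ^ 2) (weightedMeasure μ w)) ∧
      (∀ i : Fin r, Integrable (fun x => uw i x • φ x) (weightedMeasure μ w)) ∧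
      Summable lamw) ∧
    -- 1) the minimal mean-squared error
    IsLeast (projError (weightedMeasure μ w) φ '' {P | IsOrthProjOfRank r P})
      (∑' i, lamw (r + i)) ∧
    -- 2) any top `r` eigenvectors of `K` give a minimiser `V Vᵀ`; their eigenvalues are `lamw`
    (∀ (κ : Fin r → ℝ) (v : Fin r → EllTwo), IsTopEigenvectors K κ v →
      (∀ i, κ i = lamw i) ∧
      IsOrthProjOfRank r (columns v ∘L columnsT v) ∧
      projError (weightedMeasure μ w) φ (columns v ∘L columnsT v) = ∑' i, lamw (r + i)) ∧
    -- 3) for the top `r` eigenvectors that correspond to the eigenfunctions `uw`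
    (∀ v : Fin r → EllTwo,
      (∀ i, v i = pairedVector (weightedMeasure μ w) φ lamw uw i) →
      IsTopEigenvectors K (fun i => lamw i) v ∧
      ∀ x, columnsT v (φ x) = truncate r (φw x)) := by 
  have hw_integrable : Integrable w μ := integrable_of_continuous hw_cont
  have hprob := isProbabilityMeasure_weightedMeasure hw_integrable hw_pos hw_int
  have hpos := isOpenPosMeasure_weightedMeasure (μ := μ) hw_cont.measurable hw_pos
  -- From here on `φ` matters only as a feature map of `f`; apart from square-summability of its
  -- coordinates, the system for `μ` plays no further role.
  have hφf : ∀ x y, ⟪φ x, φ y⟫_ℝ = f x y := hφ ▸ hsys.inner_mercerFeatureMap hf_cont hf_psd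
  have hφc : Continuous φ := continuous_of_inner_eq_kernel hf_cont hφf
  have hE : IsEigensystem K lamw (pairedVector (weightedMeasure μ w) φ lamw uw) :=
    hK ▸ isEigensystem_featureEigenvector hsysw hφc hφf
  have hlam := hasSum_eigenvalue hsysw hφc hφf
  have hne : ∀ i < r, lamw i ≠ 0 := fun i hi =>
    ne_zero_of_lt_eigenvalueRank hsysw.antitone hsysw.nonneg hr hi
  have htail : ∑' i, lamw (r + i)
      = ∫ x, ‖φ x‖ ^ 2 ∂(weightedMeasure μ w) - ∑ k ∈ Finset.range r, lamw k := by
    rw [← ((hasSum_nat_add_iff' r).2 hlam).tsum_eq]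
    simp_rw [add_comm]
  have herr : ∀ b : Fin r → EllTwo, Orthonormal ℝ b →
      projError (weightedMeasure μ w) φ (columns b ∘L columnsT b)
        = ∫ x, ‖φ x‖ ^ 2 ∂(weightedMeasure μ w) - ∑ j, ⟪b j, K (b j)⟫_ℝ :=
    fun b hb => hK ▸ projError_columns hφc hb
  have htop := hE.isTopEigenvectors hne
  have hmin : ∀ (κ : Fin r → ℝ) (v : Fin r → EllTwo), IsTopEigenvectors K κ v →
      projError (weightedMeasure μ w) φ (columns v ∘L columnsT v) = ∑' i, lamw (r + i) := by
    intro κ v hv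
    rw [herr v hv.orthonormal, hv.sum_inner, htail, ← Fin.sum_univ_eq_sum_range]
    simp_rw [hv.eigenvalue_eq hE hne]
  refine ⟨⟨hsys.memℓp hf_cont hf_psd, hsysw.memℓp hf_cont hf_psd, integrable_rankOne hφc,
    fun P _ => integrable_of_continuous (by fun_prop), fun i => ?_, hlam.summable⟩,
    ⟨⟨_, htop.orthonormal.isOrthProjOfRank_columns, hmin _ _ htop⟩, ?_⟩,
    fun κ v hv => ⟨hv.eigenvalue_eq hE hne, hv.orthonormal.isOrthProjOfRank_columns, hmin κ v hv⟩,
    fun v hv => ?_⟩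
  · have := hsysw.continuous i (hne i i.2)
    exact integrable_of_continuous (by fun_prop)
  · rintro _ ⟨P, hP, rfl⟩
    obtain ⟨b, hb, rfl⟩ := hP.exists_orthonormal
    rw [herr b hb, htail]
    exact sub_le_sub_left (hE.sum_inner_map_le hb) _
  · obtain rfl : v = fun i : Fin r => pairedVector (weightedMeasure μ w) φ lamw uw i := funext hv
    refine ⟨htop, fun x => ?_⟩
    ext i
    rw [columnsT_apply]
    refine (inner_featureEigenvector_apply hsysw hφc hφf i x).trans ?_
    rw [truncate, hφw]
    exact (mercerFeatureMap_coe (hsysw.memℓp hf_cont hf_psd x) i).symm
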